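/- Let $K$ be a field and $n\ge 3$ an integer, and read all indices of variables modulo $n$. Let $S=K[x_0,\dots,x_{n-1}]$, let $C_n$ be the cycle with vertices $x_0,\dots,x_{n-1}$ and edges $\{x_i,x_{i+1}\}$, and let $I=I_{n-2}(C_n)\subset S$ be its $(n-2)$-path ideal, i.e. the ideal generated by the products $x_{i_1}\cdots x_{i_{n-2}}$ over all paths $x_{i_1},\dots,x_{i_{n-2}}$ with $n-2$ distinct vertices in $C_n$. Let $T=K[x_0,\dots,x_{n-1},y_0,\dots,y_{n-1}]$, and let $L\subset T$ be the defining ideal of the symmetric algebra of the $S$-module $I$, i.e. the kernel of the $S$-algebra homomorphism $T\to \operatorname{Sym}_S(I)$ that sends $y_j$ to the degree-one element $x_jx_{j+1}\cdots x_{j+n-3}\in I$. Put $$f_j=x_{j-2}y_j-x_jy_{j+1}\quad(1\le j\le n-1),$$ $$g_k=x_{2k-2}\prod_{\substack{0\le i<2k\\ i\text{ odd}}}y_i-x_{n-2}\prod_{\substack{0\le i<2k\\ i\text{ even}}}y_i\quad(1\le k\le \lfloor n/2\rfloor).$$ **Theorem.** The polynomials $f_1,\dots,f_{n-1},g_1,\dots,g_{\lfloor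 n/2\rfloor}$ generate $L$, and they form a Gröbner basis of $L$ (they are nonzero elements of $L$ whose leading terms generate the initial ideal of $L$) with respect to every monomial order $<$ on $T$ which is the product order of $<_1$ and $<_2$, where $<_1$ is the (graded) reverse lexicographic order on $K[y_0,\dots,y_{n-1}]$ induced by $y_1>y_2>\dots>y_{n-1}>y_0$ and $<_2$ is an arbitrary monomial order on $S$. Here the product order compares the $y$-parts of two monomials by $<_1$ first and, if these are equal, their $x$-parts by $<_2$. -/

import Mathlib

open scoped MonomialOrder

noncomputable section

namespace CyclePath

/-! ### Path ideals of graphs and of cycles -/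

/-- `p` is a `t`-path of the simple graph `G`: a sequence of `t` distinct vertices in which
consecutive vertices are joined by an edge. -/
def IsTPath {V : Type*} (G : SimpleGraph V) {t : ℕ} (p : Fin t → V) : Prop :=
  Function.Injective p ∧
    ∀ (i : ℕ) (h : i + 1 < t), G.Adj (p ⟨i, Nat.lt_of_succ_lt h⟩) (p ⟨i + 1, h⟩)

/-- The `t`-path ideal `I_t(G)` in the polynomial ring `S = K[x_v | v ∈ V]`. -/
def pathIdeal (K : Type*) [Field K] {V : Type*} (G : SimpleGraph V) (t : ℕ) :
    Ideal (MvPolynomial V K) :=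
  Ideal.span {u | ∃ p : Fin t → V, IsTPath G p ∧ u = ∏ i, MvPolynomial.X (p i)}

/-- The `n`-cycle (for `3 ≤ n`), with vertex set `ℤ/n` and edges `{i, i + 1}`. -/
def cycle (n : ℕ) : SimpleGraph (ZMod n) := SimpleGraph.circulantGraph {1}

/-- The monomial `x_j x_{j+1} ⋯ x_{j+t-1}`, indices modulo `n`. -/
def arcMonomial (K : Type*) [Field K] (n t : ℕ) (j : ZMod n) : MvPolynomial (ZMod n) K :=
  ∏ i : Fin t, MvPolynomial.X (j + ((i : ℕ) : ZMod n))

theorem arcMonomial_mem (K : Type*) [Field K] {n t : ℕ} (hn : 2 ≤ n) (ht : t ≤ n) (j : ZMod n) :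
    arcMonomial K n t j ∈ pathIdeal K (cycle n) t := by
  refine Ideal.subset_span ⟨fun i => j + ((i : ℕ) : ZMod n), ⟨?_, ?_⟩, rfl⟩
  · intro a b hab
    have h := (ZMod.natCast_eq_natCast_iff' _ _ _).1 (add_left_cancel hab)
    rw [Nat.mod_eq_of_lt (a.2.trans_le ht), Nat.mod_eq_of_lt (b.2.trans_le ht)] at h
    exact Fin.ext h
  · intro i h
    have : Fact (1 < n) := ⟨hn⟩
    simp [cycle, SimpleGraph.circulantGraph]

/-! ### The defining ideal of the symmetric algebra -/

/-- Let `I` be an ideal of `S = K[x_i | i ∈ σ]` and `u_j` (`j ∈ ι`) elements of `I`. This is the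
kernel of the homomorphism of `S`-algebras from `T = K[x_i, y_j]` to the symmetric algebra
`Sym_S(I)` that sends `y_j` to the element `u_j` of degree one; the variables of `T` are
`x_i = X (Sum.inl i)` and `y_j = X (Sum.inr j)`. If the `u_j` generate `I`, this homomorphism is
onto, and the kernel is the defining ideal of `Sym_S(I)`. -/
def symDefiningIdeal {K σ ι : Type*} [Field K] (I : Ideal (MvPolynomial σ K)) (u : ι → I) :
    Ideal (MvPolynomial (σ ⊕ ι) K) :=
  RingHom.ker (MvPolynomial.eval₂Hom
    ((algebraMap (MvPolynomial σ K) (SymmetricAlgebra (MvPolynomial σ K) I)).comp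
      MvPolynomial.C)
    (Sum.elim (fun i => algebraMap (MvPolynomial σ K) _ (MvPolynomial.X i))
      (fun j => SymmetricAlgebra.ι (MvPolynomial σ K) I (u j))))

/-- The defining ideal `L` of the symmetric algebra of `I_{n-2}(C_n)`, with `y_j` mapped to
`x_j x_{j+1} ⋯ x_{j+n-3}`. -/
def idealL (K : Type*) [Field K] (n : ℕ) (hn : 3 ≤ n) :
    Ideal (MvPolynomial (ZMod n ⊕ ZMod n) K) :=
  symDefiningIdeal (pathIdeal K (cycle n) (n - 2))
    (fun j => ⟨arcMonomial K n (n - 2) j,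
      arcMonomial_mem K (Nat.le_of_succ_le hn) (Nat.sub_le n 2) j⟩)

/-! ### The polynomials `f_j` and `g_k` -/

/-- The variable `x_i` of `T`, index modulo `n`. -/
def x (K : Type*) [Field K] (n : ℕ) (i : ZMod n) : MvPolynomial (ZMod n ⊕ ZMod n) K :=
  MvPolynomial.X (Sum.inl i)

/-- The variable `y_j` of `T`, index modulo `n`. -/
def y (K : Type*) [Field K] (n : ℕ) (j : ZMod n) : MvPolynomial (ZMod n ⊕ ZMod n) K :=
  MvPolynomial.X (Sum.inr j)

/-- `f_j = x_{j-2} y_j - x_j y_{j+1}`. -/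
def f (K : Type*) [Field K] (n j : ℕ) : MvPolynomial (ZMod n ⊕ ZMod n) K :=
  x K n ((j : ZMod n) - 2) * y K n (j : ZMod n) - x K n (j : ZMod n) * y K n ((j : ZMod n) + 1)

/-- `g_k = x_{2k-2} ∏_{i ∈ [0,2k), i odd} y_i - x_{n-2} ∏_{i ∈ [0,2k), i even} y_i`. -/
def g (K : Type*) [Field K] (n k : ℕ) : MvPolynomial (ZMod n ⊕ ZMod n) K :=
  x K n (2 * (k : ZMod n) - 2) * ∏ i ∈ (Finset.range (2 * k)).filter Odd, y K n (i : ZMod n) -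
    x K n ((n : ZMod n) - 2) * ∏ i ∈ (Finset.range (2 * k)).filter Even, y K n (i : ZMod n)

/-- The set `{f_1, …, f_{n-1}, g_1, …, g_{⌊n/2⌋}}`. -/
def generators (K : Type*) [Field K] (n : ℕ) : Set (MvPolynomial (ZMod n ⊕ ZMod n) K) :=
  {p | ∃ j, 1 ≤ j ∧ j ≤ n - 1 ∧ p = f K n j} ∪ {p | ∃ k, 1 ≤ k ∧ k ≤ n / 2 ∧ p = g K n k}

/-! ### Monomial orders and Gröbner bases -/

/-- `m` is the (graded) reverse lexicographic order for the order of the variables in which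
variable `i` is greater than variable `j` if and only if `pos i < pos j` (`pos` injective):
monomials are compared by total degree first; of two monomials of the same degree the smaller one
is that with the larger exponent at the smallest variable at which the exponents differ. -/
def IsRevLex {σ : Type*} (m : MonomialOrder σ) (pos : σ → ℕ) : Prop :=
  ∀ a b : σ →₀ ℕ, a ≺[m] b ↔
    a.degree < b.degree ∨
      (a.degree = b.degree ∧ ∃ i, b i < a i ∧ ∀ j, pos i < pos j → a j = b j)

/-- `m` is the product order of `m₁` (on the monomials in the variables `Sum.inr j`) and `m₂`
(on the monomials in the variables `Sum.inl i`): the `Sum.inr` parts are compared by `m₁` first,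
and ties are broken by comparing the `Sum.inl` parts by `m₂`. -/
def IsProductOrder {σ ι : Type*} (m : MonomialOrder (σ ⊕ ι)) (m₁ : MonomialOrder ι)
    (m₂ : MonomialOrder σ) : Prop :=
  ∀ a b : σ ⊕ ι →₀ ℕ, a ≺[m] b ↔
    (Finsupp.sumFinsuppEquivProdFinsupp a).2 ≺[m₁] (Finsupp.sumFinsuppEquivProdFinsupp b).2 ∨
      ((Finsupp.sumFinsuppEquivProdFinsupp a).2 = (Finsupp.sumFinsuppEquivProdFinsupp b).2 ∧
        (Finsupp.sumFinsuppEquivProdFinsupp a).1 ≺[m₂] (Finsupp.sumFinsuppEquivProdFinsupp b).1)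

/-- The initial ideal `in_m(I)`. -/
def initialIdeal {K σ : Type*} [Field K] (m : MonomialOrder σ) (I : Ideal (MvPolynomial σ K)) :
    Ideal (MvPolynomial σ K) :=
  Ideal.span (m.leadingTerm '' (I : Set (MvPolynomial σ K)))

/-- `G` is a Gröbner basis of the ideal `I` with respect to `m`: a finite set of nonzero elements
of `I` whose leading terms generate the initial ideal of `I`. -/
def IsGroebnerBasis {K σ : Type*} [Field K] (m : MonomialOrder σ)
    (G : Set (MvPolynomial σ K)) (I : Ideal (MvPolynomial σ K)) : Prop :=
  G.Finite ∧ (∀ p ∈ G, p ≠ 0) ∧ G ⊆ I ∧ initialIdeal m I = Ideal.span (m.leadingTerm '' G)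

end CyclePath

end

/-! ### Rewriting of monomials and confluence -/

namespace BinomialRewriting

open Relation MvPolynomial
open scoped MonomialOrder

/-! Every generator is a difference of two monomials, so reduction modulo the generators is a
rewriting system on monomials. Buchberger's criterion then takes a combinatorial form: each rule
lowers the monomial order, and every critical pair can be joined. By Newman's lemma normal forms are
unique, so the linear map that replaces each monomial by its normal form kills the ideal. An
irreducible leading monomial would survive under this map, which is impossible (`exists_le_degree`).

Rules with coprime left hand sides need no work. The remaining overlaps are $f_{2k}$ with $g_k$
(common factor $x_{2k-2}$), $f_{2i+1}$ with $g_k$ for $i<k$ (common factor $y_{2i+1}$), and $g_k$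
with $g_{k+t}$ (common factor $y_1y_3\cdots y_{2k-1}$). They are joined by two composite reductions:
`reduces_chain` pushes an $x$ past a string of $y$'s of equal parity, and `reduces_transport` moves
$x_{j-2}x_{j-1}y_j$ around the cycle to $x_{n-2}x_{n-1}y_0$.

That the generators span $L$ is shown independently. For an ideal generated by monomials $u_j$, the
relations $ay_i-by_j$ with $au_i=bu_j$ generate $L$ (`symDefiningIdeal_le`). Here $u_j$ is
complementary to the edge $x_{j-2}x_{j-1}$. Two consecutive edges give a multiple of some $f_j$; two
disjoint edges give a multiple of a telescoping sum of such forms (`syzygy_mem_span`). The form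
$f_0$, absent from the list, is $-g_1$. Conversely $g_k\in L$ follows from $f_j\in L$ by the
recursion `g_succ`. -/

/-- Newman's lemma: a terminating, locally confluent relation is confluent. -/
theorem newman {α : Type*} {r : α → α → Prop} (wf : WellFounded (flip r))
    (h : ∀ a b c, r a b → r a c → Join (ReflTransGen r) b c) (a : α) :
    ∀ b c, ReflTransGen r a b → ReflTransGen r a c → Join (ReflTransGen r) b c := by
  induction a using wf.induction with
  | _ a ih =>
    intro b c hb hc
    rcases hb.cases_head with rfl | ⟨b', hab, hbb⟩
    · exact ⟨c, hc, .refl⟩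
    rcases hc.cases_head with rfl | ⟨c', hac, hcc⟩
    · exact ⟨b, .refl, .head hab hbb⟩
    obtain ⟨d, hd1, hd2⟩ := h a b' c' hab hac
    obtain ⟨e, he1, he2⟩ := ih b' hab b d hbb hd1
    obtain ⟨e', he1', he2'⟩ := ih c' hac e c (hd2.trans he2) hcc
    exact ⟨e', he1.trans he1', he2'⟩

variable {σ : Type*}

/-- One step of rewriting of monomials: the rule `p` replaces the factor `p.1` by `p.2`. -/
def Step (R : Set ((σ →₀ ℕ) × (σ →₀ ℕ))) (a b : σ →₀ ℕ) : Prop :=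
  ∃ p ∈ R, ∃ w, a = p.1 + w ∧ b = p.2 + w

/-- Rewriting of monomials in finitely many steps. -/
abbrev Reduces (R : Set ((σ →₀ ℕ) × (σ →₀ ℕ))) : (σ →₀ ℕ) → (σ →₀ ℕ) → Prop :=
  ReflTransGen (Step R)

/-- The critical pair of the rules `p` and `q`, whose left hand sides have the greatest common
divisor `c`, can be joined. -/
def CriticalPairJoins (R : Set ((σ →₀ ℕ) × (σ →₀ ℕ))) (p q : (σ →₀ ℕ) × (σ →₀ ℕ)) : Prop :=
  ∃ c d e, p.1 = c + d ∧ q.1 = c + e ∧ (∀ z, d z = 0 ∨ e z = 0) ∧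
    Join (Reduces R) (p.2 + e) (q.2 + d)

variable {R : Set ((σ →₀ ℕ) × (σ →₀ ℕ))}

theorem CriticalPairJoins.symm {p q : (σ →₀ ℕ) × (σ →₀ ℕ)} (h : CriticalPairJoins R p q) :
    CriticalPairJoins R q p := by
  obtain ⟨c, d, e, h1, h2, h3, x, h4, h5⟩ := h
  exact ⟨c, e, d, h2, h1, fun z => (h3 z).symm, x, h5, h4⟩

theorem CriticalPairJoins.refl (p : (σ →₀ ℕ) × (σ →₀ ℕ)) : CriticalPairJoins R p p :=
  ⟨p.1, 0, 0, by simp, by simp, by simp, _, .refl, .refl⟩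

theorem Reduces.of_mem {a b : σ →₀ ℕ} (h : (a, b) ∈ R) : Reduces R a b :=
  .single ⟨_, h, 0, by simp, by simp⟩

theorem Reduces.add_right {a b : σ →₀ ℕ} (h : Reduces R a b) (w : σ →₀ ℕ) :
    Reduces R (a + w) (b + w) := by
  induction h with
  | refl => exact .refl
  | tail _ hs ih =>
    obtain ⟨p, hp, v, rfl, rfl⟩ := hs
    exact ih.tail ⟨p, hp, v + w, by rw [add_assoc], by rw [add_assoc]⟩

theorem Reduces.add_of_eq {a b c d : σ →₀ ℕ} (h : Reduces R a b) (w : σ →₀ ℕ)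
    (hc : c = a + w) (hd : d = b + w) : Reduces R c d := by
  subst hc hd
  exact h.add_right w

/-- Critical pairs of rules with coprime left hand sides can be joined. -/
theorem CriticalPairJoins.of_disjoint {p q : (σ →₀ ℕ) × (σ →₀ ℕ)} (hp : p ∈ R) (hq : q ∈ R)
    (h : ∀ z, p.1 z = 0 ∨ q.1 z = 0) : CriticalPairJoins R p q :=
  ⟨0, p.1, q.1, by simp, by simp, h, p.2 + q.2,
    (Reduces.of_mem hq).add_of_eq p.2 (add_comm _ _) (add_comm _ _),
    (Reduces.of_mem hp).add_of_eq q.2 (add_comm _ _) rfl⟩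

theorem exists_eq_add_of_add_eq_add {d e v w : σ →₀ ℕ} (h : ∀ z, d z = 0 ∨ e z = 0)
    (hvw : d + v = e + w) : ∃ u, v = e + u ∧ w = d + u := by
  refine ⟨v - e, ?_, ?_⟩ <;> ext z <;>
  · have h1 := DFunLike.congr_fun hvw z
    have h2 := h z
    simp only [Finsupp.add_apply, Finsupp.tsub_apply] at h1 ⊢
    omega

/-- A monomial to which both rules apply is a multiple of the least common multiple $c+d+e$ of their
left hand sides, so the two results are a critical pair translated by the same $u$. -/
theorem locallyConfluent (h : ∀ p ∈ R, ∀ q ∈ R, CriticalPairJoins R p q) (a b c : σ →₀ ℕ)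
    (hb : Step R a b) (hc : Step R a c) : Join (Reduces R) b c := by
  obtain ⟨p, hp, v, rfl, rfl⟩ := hb
  obtain ⟨q, hq, w, hpq, rfl⟩ := hc
  obtain ⟨c, d, e, h1, h2, h3, x, h4, h5⟩ := h p hp q hq
  obtain ⟨u, rfl, rfl⟩ := exists_eq_add_of_add_eq_add h3
    (add_left_cancel (a := c) (b := d + v) (c := e + w)
      (by rw [← add_assoc, ← add_assoc, ← h1, ← h2, hpq]))
  exact ⟨x + u, h4.add_of_eq u (add_assoc _ _ _).symm rfl,
    h5.add_of_eq u (add_assoc _ _ _).symm rfl⟩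

variable (m : MonomialOrder σ)

theorem Step.lt (hR : ∀ p ∈ R, p.2 ≺[m] p.1) {a b : σ →₀ ℕ} (h : Step R a b) : b ≺[m] a := by
  obtain ⟨p, hp, w, rfl, rfl⟩ := h
  simpa using hR p hp

theorem wellFounded_flip_step (hR : ∀ p ∈ R, p.2 ≺[m] p.1) : WellFounded (flip (Step R)) :=
  Subrelation.wf (fun {_ _} h => Step.lt m hR h) (InvImage.wf m.toSyn wellFounded_lt)

theorem Reduces.le (hR : ∀ p ∈ R, p.2 ≺[m] p.1) {a b : σ →₀ ℕ} (h : Reduces R a b) :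
    b ≼[m] a := by
  induction h with
  | refl => exact le_rfl
  | tail _ hs ih => exact (hs.lt m hR).le.trans ih

theorem exists_normalForm (hR : ∀ p ∈ R, p.2 ≺[m] p.1) (a : σ →₀ ℕ) :
    ∃ b, Reduces R a b ∧ ∀ c, ¬ Step R b c := by
  induction a using (wellFounded_flip_step m hR).induction with
  | _ a ih =>
    by_cases h : ∃ b, Step R a b
    · obtain ⟨b, hb⟩ := h
      obtain ⟨c, hc, hc'⟩ := ih b hb
      exact ⟨c, .head hb hc, hc'⟩
    · exact ⟨a, .refl, fun c hc => h ⟨c, hc⟩⟩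

theorem eq_of_reduces_of_irreducible {a b : σ →₀ ℕ} (h : Reduces R a b)
    (ha : ∀ c, ¬ Step R a c) : a = b := by
  rcases h.cases_head with rfl | ⟨c, hc, _⟩
  · rfl
  · exact (ha c hc).elim

/-- If all critical pairs of a terminating set of rules can be joined, then the leading monomial
of a nonzero element of the ideal generated by the corresponding binomials is divisible by the
left hand side of a rule. -/
theorem exists_le_degree {K : Type*} [CommRing K]
    (hR : ∀ p ∈ R, p.2 ≺[m] p.1) (h : ∀ p ∈ R, ∀ q ∈ R, CriticalPairJoins R p q)
    {J : Ideal (MvPolynomial σ K)}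
    (hJ : J ≤ Ideal.span ((fun p => monomial p.1 (1 : K) - monomial p.2 1) '' R))
    {q : MvPolynomial σ K} (hq : q ∈ J) (hq0 : q ≠ 0) : ∃ p ∈ R, p.1 ≤ m.degree q := by
  classical
  choose N hN hN' using exists_normalForm m hR
  -- Confluence makes the chosen normal form invariant under rewriting.
  have hstep : ∀ a b, Step R a b → N a = N b := fun a b hab => by
    obtain ⟨d, hd, hd'⟩ := newman (wellFounded_flip_step m hR) (locallyConfluent h) a (N a) (N b)
      (hN a) (.head hab (hN b))
    rw [eq_of_reduces_of_irreducible hd (hN' a), eq_of_reduces_of_irreducible hd' (hN' b)]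
  let Φ : MvPolynomial σ K →ₗ[K] MvPolynomial σ K :=
    (basisMonomials σ K).constr K fun a => monomial (N a) (1 : K)
  have hΦ : ∀ a c, Φ (monomial a c) = monomial (N a) c := fun a c => by
    have h1 : Φ (monomial a 1) = monomial (N a) 1 := by
      have := (basisMonomials σ K).constr_basis K (fun a => monomial (N a) (1 : K)) a
      rwa [coe_basisMonomials] at this
    rw [← mul_one c, ← smul_eq_mul, ← smul_monomial, map_smul, h1, smul_monomial]
  -- `Φ` is only `K`-linear, so the induction over the span carries an arbitrary multiplier `r`.
  have hker : ∀ r, Φ (r * q) = 0 := by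
    refine Submodule.span_induction (p := fun q _ => ∀ r, Φ (r * q) = 0) ?_ (by simp) ?_ ?_ (hJ hq)
    · rintro _ ⟨p, hp, rfl⟩ r
      induction r using MvPolynomial.induction_on' with
      | monomial w c =>
        rw [mul_sub, monomial_mul, monomial_mul, map_sub, hΦ, hΦ,
          hstep (w + p.1) (w + p.2) ⟨p, hp, w, add_comm _ _, add_comm _ _⟩, sub_self]
      | add x y hx hy => rw [add_mul, map_add, hx, hy, add_zero]
    · intro x y _ _ hx hy r
      rw [mul_add, map_add, hx, hy, add_zero]
    · intro a x _ hx r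
      rw [smul_eq_mul, ← mul_assoc, hx]
  by_contra! hcon
  have hirr : ∀ c, ¬ Step R (m.degree q) c := by
    rintro c ⟨p, hp, w, hw, -⟩
    exact hcon p hp (hw ▸ le_self_add)
  have hNa : N (m.degree q) = m.degree q := (eq_of_reduces_of_irreducible (hN _) hirr).symm
  have hcoeff : coeff (m.degree q) (Φ q) = coeff (m.degree q) q := by
    have hsum : Φ q = ∑ b ∈ q.support, monomial (N b) (coeff b q) := by
      conv_lhs => rw [q.as_sum, map_sum]
      exact Finset.sum_congr rfl fun b _ => hΦ b _
    rw [hsum, coeff_sum, Finset.sum_eq_single (m.degree q)]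
    · rw [hNa, coeff_monomial, if_pos rfl]
    -- Reduction never increases a monomial, so no smaller monomial of `q` has the leading monomial
    -- as its normal form.
    · intro b hb hne
      rw [coeff_monomial, if_neg]
      intro hNb
      have h1 := (hN b).le m hR
      rw [hNb] at h1
      exact hne (m.toSyn.injective (le_antisymm (m.le_degree hb) h1))
    · intro hb
      rw [hNa, coeff_monomial, if_pos rfl]
      simpa using hb
  have h0 := hker 1
  rw [one_mul] at h0
  rw [h0, coeff_zero] at hcoeff
  exact m.coeff_degree_ne_zero_iff.2 hq0 hcoeff.symm

end BinomialRewriting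

/-! ### The rewriting rules of the cycle and their critical pairs -/

namespace CyclePath

open BinomialRewriting Relation

/-- The exponent of the variable `x_{j-2}`. -/
noncomputable def expX (n j : ℕ) : ZMod n ⊕ ZMod n →₀ ℕ := Finsupp.single (.inl ((j : ZMod n) - 2)) 1

/-- The exponent of the variable `y_j`. -/
noncomputable def expY (n j : ℕ) : ZMod n ⊕ ZMod n →₀ ℕ := Finsupp.single (.inr (j : ZMod n)) 1

/-- The exponent of the monomial `y_j y_{j+2} ⋯ y_{j+2(r-1)}`. -/
noncomputable def expYs (n j r : ℕ) : ZMod n ⊕ ZMod n →₀ ℕ := ∑ s ∈ Finset.range r, expY n (j + 2 * s)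

/-- The rule `x_{j-2} y_j → x_j y_{j+1}` given by `f_j`. -/
noncomputable def ruleF (n j : ℕ) : (ZMod n ⊕ ZMod n →₀ ℕ) × (ZMod n ⊕ ZMod n →₀ ℕ) :=
  (expX n j + expY n j, expX n (j + 2) + expY n (j + 1))

/-- The rule `x_{2k-2} y_1 y_3 ⋯ y_{2k-1} → x_{n-2} y_0 y_2 ⋯ y_{2k-2}` given by `g_k`. -/
noncomputable def ruleG (n k : ℕ) : (ZMod n ⊕ ZMod n →₀ ℕ) × (ZMod n ⊕ ZMod n →₀ ℕ) :=
  (expX n (2 * k) + expYs n 1 k, expX n 0 + expYs n 0 k)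

/-- The rewriting rules given by the polynomials `f_j` and `g_k`. -/
def rules (n : ℕ) : Set ((ZMod n ⊕ ZMod n →₀ ℕ) × (ZMod n ⊕ ZMod n →₀ ℕ)) :=
  {p | ∃ j, 1 ≤ j ∧ j ≤ n - 1 ∧ p = ruleF n j} ∪ {p | ∃ k, 1 ≤ k ∧ k ≤ n / 2 ∧ p = ruleG n k}

variable {n : ℕ}

theorem natCast_ne_natCast {a b : ℕ} (hab : a < b) (hba : b < a + n) : (a : ZMod n) ≠ b := by
  intro h
  rw [ZMod.natCast_eq_natCast_iff, Nat.modEq_iff_dvd' hab.le] at h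
  exact absurd (Nat.le_of_dvd (by omega) h) (by omega)

theorem expX_add_self (j : ℕ) : expX n (n + j) = expX n j := by simp [expX]

theorem expY_self : expY n n = expY n 0 := by simp [expY]

theorem expX_self : expX n n = expX n 0 := by simp [expX]

@[simp]
theorem expX_apply_inr (j : ℕ) (z : ZMod n) : expX n j (.inr z) = 0 := by simp [expX]

@[simp]
theorem expY_apply_inl (j : ℕ) (z : ZMod n) : expY n j (.inl z) = 0 := by simp [expY]

@[simp]
theorem expYs_apply_inl (j r : ℕ) (z : ZMod n) : expYs n j r (.inl z) = 0 := by
  simp [expYs, Finsupp.finsetSum_apply]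

theorem expX_apply_inl_eq_zero {j : ℕ} {z : ZMod n} (h : (j : ZMod n) - 2 ≠ z) :
    expX n j (.inl z) = 0 := by
  simp [expX, h]

theorem expY_apply_inr_eq_zero {j : ℕ} {z : ZMod n} (h : (j : ZMod n) ≠ z) :
    expY n j (.inr z) = 0 := by
  simp [expY, h]

theorem expYs_apply_inr_eq_zero {j r : ℕ} {z : ZMod n}
    (h : ∀ s < r, ((j + 2 * s : ℕ) : ZMod n) ≠ z) : expYs n j r (.inr z) = 0 := by
  rw [expYs, Finsupp.finsetSum_apply]
  exact Finset.sum_eq_zero fun s hs => expY_apply_inr_eq_zero (h s (Finset.mem_range.1 hs))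

theorem expYs_zero (j : ℕ) : expYs n j 0 = 0 := rfl

theorem expYs_succ (j r : ℕ) : expYs n j (r + 1) = expYs n j r + expY n (j + 2 * r) :=
  Finset.sum_range_succ _ _

theorem expYs_add (j r t : ℕ) : expYs n j (r + t) = expYs n j r + expYs n (j + 2 * r) t := by
  rw [expYs, Finset.sum_range_add, expYs, expYs]
  simp only [mul_add, add_assoc]

theorem expYs_one (j : ℕ) : expYs n j 1 = expY n j := by simp [expYs]

theorem reduces_ruleF {j : ℕ} (h1 : 1 ≤ j) (h2 : j + 1 ≤ n) :
    Reduces (rules n) (expX n j + expY n j) (expX n (j + 2) + expY n (j + 1)) :=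
  Reduces.of_mem (.inl ⟨j, h1, by omega, rfl⟩)

theorem reduces_ruleG {k : ℕ} (h1 : 1 ≤ k) (h2 : 2 * k ≤ n) :
    Reduces (rules n) (expX n (2 * k) + expYs n 1 k) (expX n 0 + expYs n 0 k) :=
  Reduces.of_mem (.inr ⟨k, h1, by omega, rfl⟩)

/-- `x_{j-2} y_j y_{j+2} ⋯ y_{j+2r-2}` reduces to `x_{j+2r-2} y_{j+1} y_{j+3} ⋯ y_{j+2r-1}`. -/
theorem reduces_chain {j : ℕ} (hj : 1 ≤ j) (r : ℕ) (h : j + 2 * r ≤ n + 1) :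
    Reduces (rules n) (expX n j + expYs n j r) (expX n (j + 2 * r) + expYs n (j + 1) r) := by
  induction r with
  | zero => exact .refl
  | succ r ih =>
    refine ((ih (by omega)).add_of_eq (expY n (j + 2 * r)) (by rw [expYs_succ, add_assoc])
      rfl).trans ((reduces_ruleF (j := j + 2 * r) (by omega) (by omega)).add_of_eq
        (expYs n (j + 1) r) (by abel) ?_)
    rw [expYs_succ, show j + 2 * (r + 1) = j + 2 * r + 2 by ring,
      show j + 1 + 2 * r = j + 2 * r + 1 by ring]
    abel

/-- `x_{j-2} x_{j-1} y_j` reduces to `x_{n-2} x_{n-1} y_0`. -/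
theorem reduces_transport {j : ℕ} (hj : 1 ≤ j) (h : j ≤ n) :
    Reduces (rules n) (expX n j + expX n (j + 1) + expY n j)
      (expX n 0 + expX n 1 + expY n 0) := by
  induction h using Nat.decreasingInduction with
  | self => rw [expX_self, expX_add_self, expY_self]
  | of_succ j h ih =>
    exact ((reduces_ruleF hj h).add_of_eq (expX n (j + 1)) (by abel) rfl).trans
      ((ih (by omega)).add_of_eq 0 (by rw [add_zero]; abel) (by rw [add_zero]))

theorem criticalPair_ruleF_ruleF {i j : ℕ} (hi : 1 ≤ i) (hi' : i ≤ n - 1) (hij : i < j)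
    (hj' : j ≤ n - 1) : CriticalPairJoins (rules n) (ruleF n i) (ruleF n j) := by
  have hne : (i : ZMod n) ≠ j := natCast_ne_natCast hij (by omega)
  refine .of_disjoint (.inl ⟨i, hi, hi', rfl⟩) (.inl ⟨j, by omega, hj', rfl⟩) ?_
  rintro (z | z)
  · by_cases hz : (i : ZMod n) - 2 = z
    · right
      have : expX n j (.inl z) = 0 := expX_apply_inl_eq_zero (by
        rw [← hz]; simpa using hne.symm)
      simp [ruleF, this]
    · left
      simp [ruleF, expX_apply_inl_eq_zero hz]
  · by_cases hz : (i : ZMod n) = z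
    · right
      have : expY n j (.inr z) = 0 := expY_apply_inr_eq_zero (by rw [← hz]; exact hne.symm)
      simp [ruleF, this]
    · left
      simp [ruleF, expY_apply_inr_eq_zero hz]

/-- The overlap is $x_{2k-2}y_{2k}\cdot y_1y_3\cdots y_{2k-1}$. Applying $f_{2k}$ produces the left
hand side of $g_{k+1}$, and both branches end at its right hand side. -/
theorem criticalPair_ruleF_ruleG_even {k : ℕ} (hk : 1 ≤ k) (hkn : 2 * k + 1 ≤ n) :
    CriticalPairJoins (rules n) (ruleF n (2 * k)) (ruleG n k) := by
  refine ⟨expX n (2 * k), expY n (2 * k), expYs n 1 k, rfl, rfl, ?_, ?_⟩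
  · rintro (z | z)
    · simp
    · by_cases hz : ((2 * k : ℕ) : ZMod n) = z
      · right
        exact expYs_apply_inr_eq_zero fun s hs => hz ▸ natCast_ne_natCast (by omega) (by omega)
      · exact .inl (expY_apply_inr_eq_zero hz)
  · refine ⟨expX n 0 + expYs n 0 (k + 1), ?_, ?_⟩
    · rcases hkn.lt_or_eq with hlt | heq
      · refine (reduces_ruleG (k := k + 1) (by omega) (by omega)).add_of_eq 0 ?_ (add_zero _).symm
        rw [expYs_succ, add_zero, show 2 * (k + 1) = 2 * k + 2 by ring, add_comm 1 (2 * k)]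
        simp only [ruleF]
        abel
      -- For $n=2k+1$ there is no rule $g_{k+1}$, but $x_{2k}=x_{-1}$ and $y_{2k+1}=y_0$, so the
      -- chain starting at $x_{-1}y_1$ takes its place.
      · refine (reduces_chain le_rfl k (by omega)).add_of_eq (expY n 0) ?_ ?_
        · simp only [ruleF]
          rw [show 2 * k + 2 = n + 1 by omega, heq, expX_add_self, expY_self]
          abel
        · rw [add_comm 1 (2 * k), heq, expX_self, add_comm k 1, expYs_add, expYs_one]
          simp only [mul_one, zero_add, one_add_one_eq_two]
          abel
    · rw [expYs_succ, zero_add]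
      simp only [ruleG]
      rw [add_assoc]

/-- Write $k=i+1+t$. After $f_{2i+1}$, the chain `h1` carries $x_{2i+1}$ to $x_{2k-1}$, the
transport `h2` sends $x_{2k-2}x_{2k-1}y_{2k}$ to $x_{n-2}x_{n-1}y_0$, and the chain `h3` carries
$x_{n-1}=x_{-1}$ to $x_{2i-1}$. This gives exactly the monomial obtained from $g_k$. -/
theorem criticalPair_ruleF_ruleG_odd {i t : ℕ} (hn : 2 * (i + 1 + t) ≤ n) :
    CriticalPairJoins (rules n) (ruleF n (2 * i + 1)) (ruleG n (i + 1 + t)) := by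
  refine ⟨expY n (2 * i + 1), expX n (2 * i + 1),
    expX n (2 * (i + 1 + t)) + expYs n 1 i + expYs n (2 * i + 3) t, add_comm _ _, ?_, ?_, ?_⟩
  · simp only [ruleG]
    rw [expYs_add, expYs_succ, show 1 + 2 * i = 2 * i + 1 by ring,
      show 1 + 2 * (i + 1) = 2 * i + 3 by ring]
    abel
  · rintro (z | z)
    · by_cases hz : ((2 * i + 1 : ℕ) : ZMod n) - 2 = z
      · right
        have : expX n (2 * (i + 1 + t)) (.inl z) = 0 := expX_apply_inl_eq_zero fun h =>
          natCast_ne_natCast (n := n) (a := 2 * i + 1) (b := 2 * (i + 1 + t)) (by omega) (by omega)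
            (sub_left_inj.1 (hz.trans h.symm))
        simp [this]
      · exact .inl (expX_apply_inl_eq_zero hz)
    · simp
  · refine ⟨expX n 0 + expX n (2 * i + 1) + expYs n 0 (i + 1 + t), ?_, ?_⟩
    · have h1 := reduces_chain (n := n) (j := 2 * i + 3) (by omega) t (by omega)
      have h2 := reduces_transport (n := n) (j := 2 * (i + 1 + t)) (by omega) hn
      have h3 := reduces_chain (n := n) (j := 1) le_rfl i (by omega)
      have e : expY n (2 * i + 2) + expYs n (2 * i + 4) t =
          expYs n (2 * i + 2) t + expY n (2 * (i + 1 + t)) := by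
        rw [show 2 * (i + 1 + t) = 2 * i + 2 + 2 * t by ring, ← expYs_succ, add_comm t 1,
          expYs_add, expYs_one]
      refine (h1.add_of_eq (expY n (2 * i + 2) + expX n (2 * (i + 1 + t)) + expYs n 1 i)
        ?_ rfl).trans ((h2.add_of_eq (expYs n (2 * i + 2) t + expYs n 1 i) ?_ rfl).trans
          (h3.add_of_eq (expX n 0 + expY n 0 + expYs n (2 * i + 2) t) ?_ ?_))
      · simp only [ruleF, add_assoc, Nat.reduceAdd]
        abel
      · rw [show 2 * i + 3 + 2 * t = 2 * (i + 1 + t) + 1 by ring]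
        trans expY n (2 * i + 2) + expYs n (2 * i + 4) t + expX n (2 * (i + 1 + t) + 1) +
          expX n (2 * (i + 1 + t)) + expYs n 1 i
        · abel
        · rw [e]
          abel
      · abel
      · rw [add_comm i 1, expYs_add, expYs_add, expYs_one]
        simp only [mul_one, zero_add, one_add_one_eq_two, mul_add]
        rw [add_comm 1 (2 * i), add_comm 2 (2 * i)]
        abel
    · rw [ruleG, add_right_comm]

/-- The result of $g_{k+t}$ contains $x_{2k-2}y_{2k}y_{2k+2}\cdots y_{2(k+t)-2}$, and a single chain
turns it into the result of $g_k$. -/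
theorem criticalPair_ruleG_ruleG {k t : ℕ} (hk : 1 ≤ k) (ht : 1 ≤ t) (hn : 2 * (k + t) ≤ n) :
    CriticalPairJoins (rules n) (ruleG n k) (ruleG n (k + t)) := by
  refine ⟨expYs n 1 k, expX n (2 * k), expX n (2 * (k + t)) + expYs n (1 + 2 * k) t,
    add_comm _ _, ?_, ?_, ?_⟩
  · simp only [ruleG]
    rw [expYs_add]
    abel
  · rintro (z | z)
    · by_cases hz : ((2 * k : ℕ) : ZMod n) - 2 = z
      · right
        have : expX n (2 * (k + t)) (.inl z) = 0 := expX_apply_inl_eq_zero fun h =>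
          natCast_ne_natCast (n := n) (a := 2 * k) (b := 2 * (k + t)) (by omega) (by omega)
            (sub_left_inj.1 (hz.trans h.symm))
        simp [this]
      · exact .inl (expX_apply_inl_eq_zero hz)
    · simp
  · refine ⟨_, .refl, (reduces_chain (j := 2 * k) (by omega) t (by omega)).add_of_eq
      (expX n 0 + expYs n 0 k) ?_ ?_⟩
    · simp only [ruleG]
      rw [expYs_add, zero_add]
      abel
    · simp only [ruleG]
      rw [mul_add, add_comm 1 (2 * k)]
      abel

theorem criticalPair_ruleF_ruleG {j k : ℕ} (hj : 1 ≤ j) (hj' : j ≤ n - 1) (hk : 1 ≤ k)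
    (hk' : k ≤ n / 2) : CriticalPairJoins (rules n) (ruleF n j) (ruleG n k) := by
  by_cases h1 : j = 2 * k
  · subst h1
    exact criticalPair_ruleF_ruleG_even hk (by omega)
  by_cases h2 : ∃ i < k, j = 2 * i + 1
  · obtain ⟨i, hi, rfl⟩ := h2
    obtain ⟨t, rfl⟩ := Nat.exists_eq_add_of_le (Nat.succ_le_of_lt hi)
    exact criticalPair_ruleF_ruleG_odd (by omega)
  have hne : ∀ b, 1 ≤ b → b ≤ n → b ≠ j → (b : ZMod n) ≠ j := fun b hb hb' hbj =>
    hbj.lt_or_gt.elim (fun h => natCast_ne_natCast h (by omega))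
      fun h => (natCast_ne_natCast h (by omega)).symm
  refine .of_disjoint (.inl ⟨j, hj, hj', rfl⟩) (.inr ⟨k, hk, hk', rfl⟩) ?_
  rintro (z | z)
  · by_cases hz : (j : ZMod n) - 2 = z
    · right
      have : expX n (2 * k) (.inl z) = 0 := expX_apply_inl_eq_zero fun h =>
        hne (2 * k) (by omega) (by omega) (Ne.symm h1) (sub_left_inj.1 (h.trans hz.symm))
      simp [ruleG, this]
    · left
      simp [ruleF, expX_apply_inl_eq_zero hz]
  · by_cases hz : (j : ZMod n) = z
    · right
      have : expYs n 1 k (.inr z) = 0 := expYs_apply_inr_eq_zero fun s hs =>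
        hz ▸ hne _ (by omega) (by omega) fun h => h2 ⟨s, hs, by omega⟩
      simp [ruleG, this]
    · left
      simp [ruleF, expY_apply_inr_eq_zero hz]

theorem criticalPairJoins_rules (p) (hp : p ∈ rules n) (q) (hq : q ∈ rules n) :
    CriticalPairJoins (rules n) p q := by
  rcases hp with ⟨i, hi, hi', rfl⟩ | ⟨k, hk, hk', rfl⟩ <;>
    rcases hq with ⟨j, hj, hj', rfl⟩ | ⟨l, hl, hl', rfl⟩
  · rcases lt_trichotomy i j with h | rfl | h
    · exact criticalPair_ruleF_ruleF hi hi' h hj'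
    · exact .refl _
    · exact (criticalPair_ruleF_ruleF hj hj' h hi').symm
  · exact criticalPair_ruleF_ruleG hi hi' hl hl'
  · exact (criticalPair_ruleF_ruleG hj hj' hk hk').symm
  · rcases lt_trichotomy k l with h | rfl | h
    · obtain ⟨t, rfl⟩ := Nat.exists_eq_add_of_le h.le
      exact criticalPair_ruleG_ruleG hk (by omega) (by omega)
    · exact .refl _
    · obtain ⟨t, rfl⟩ := Nat.exists_eq_add_of_le h.le
      exact (criticalPair_ruleG_ruleG hl (by omega) (by omega)).symm

end CyclePath

/-! ### Compatibility with the monomial order; binomials and rules -/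

namespace CyclePath

open BinomialRewriting MvPolynomial
open scoped MonomialOrder

variable {n : ℕ}

theorem snd_sumFinsupp_expX (j : ℕ) :
    (Finsupp.sumFinsuppEquivProdFinsupp (expX n j)).2 = 0 := by
  ext z
  simp

theorem snd_sumFinsupp_expY (j : ℕ) :
    (Finsupp.sumFinsuppEquivProdFinsupp (expY n j)).2 = Finsupp.single (j : ZMod n) 1 := by
  ext z
  simp [expY, Finsupp.single_apply]

theorem snd_sumFinsupp_add (a b : ZMod n ⊕ ZMod n →₀ ℕ) :
    (Finsupp.sumFinsuppEquivProdFinsupp (a + b)).2 =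
      (Finsupp.sumFinsuppEquivProdFinsupp a).2 + (Finsupp.sumFinsuppEquivProdFinsupp b).2 := by
  ext z
  simp

theorem degree_snd_sumFinsupp_expYs (j r : ℕ) :
    (Finsupp.sumFinsuppEquivProdFinsupp (expYs n j r)).2.degree = r := by
  induction r with
  | zero =>
    have : (Finsupp.sumFinsuppEquivProdFinsupp (expYs n j 0)).2 = 0 := by
      ext z
      simp [expYs_zero]
    rw [this, map_zero]
  | succ r ih =>
    rw [expYs_succ, snd_sumFinsupp_add, map_add, ih, snd_sumFinsupp_expY, Finsupp.degree_single]

/-- The two sides of a rule have $y$-parts of equal degree that differ, so the reverse lexicographic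
comparison decides and the order on the $x$-part never enters. -/
theorem rules_lt {m₁ m₂ : MonomialOrder (ZMod n)} {m : MonomialOrder (ZMod n ⊕ ZMod n)}
    (hm₁ : IsRevLex m₁ (fun j : ZMod n => (j - 1).val)) (hm : IsProductOrder m m₁ m₂)
    (p) (hp : p ∈ rules n) : p.2 ≺[m] p.1 := by
  rw [hm]
  left
  rw [hm₁]
  right
  rcases hp with ⟨j, hj, hj', rfl⟩ | ⟨k, hk, hk', rfl⟩
  · have : NeZero n := ⟨by omega⟩
    have hne : (j : ZMod n) ≠ (j + 1 : ℕ) := natCast_ne_natCast (by omega) (by omega)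
    simp only [ruleF, snd_sumFinsupp_add, snd_sumFinsupp_expX, snd_sumFinsupp_expY, zero_add,
      Finsupp.degree_single, true_and]
    have hval : (((j + 1 : ℕ) : ZMod n) - 1).val = j := by
      rw [Nat.cast_succ, add_sub_cancel_right, ZMod.val_natCast_of_lt (by omega)]
    have hval' : ((j : ZMod n) - 1).val = j - 1 := by
      rw [← Nat.cast_one, ← Nat.cast_sub hj, ZMod.val_natCast_of_lt (by omega)]
    -- The deciding variable is $y_{j+1}$, also for $j=n-1$, where it is $y_0$, the smallest
    -- variable.
    refine ⟨(j + 1 : ℕ), by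
      rw [Finsupp.single_eq_same, Finsupp.single_eq_of_ne hne.symm]; exact one_pos, fun i hi => ?_⟩
    rw [hval] at hi
    rw [Finsupp.single_apply, Finsupp.single_apply, if_neg, if_neg]
    · rintro rfl
      omega
    · rintro rfl
      omega
  · obtain ⟨N, rfl⟩ : ∃ N, n = N + 1 := ⟨n - 1, by omega⟩
    simp only [ruleG, snd_sumFinsupp_add, snd_sumFinsupp_expX, zero_add,
      degree_snd_sumFinsupp_expYs, true_and]
    -- The variable $y_0$ occurs only on the right hand side, because the odd indices stay below
    -- $n$. No variable is smaller.
    refine ⟨0, ?_, fun i hi => ?_⟩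
    · have h1 : expYs (N + 1) 1 k (.inr 0) = 0 := expYs_apply_inr_eq_zero fun s hs => by
        have := natCast_ne_natCast (n := N + 1) (a := 0) (b := 1 + 2 * s) (by omega) (by omega)
        rw [Nat.cast_zero] at this
        exact this.symm
      rw [Finsupp.snd_sumFinsuppEquivProdFinsupp, Finsupp.snd_sumFinsuppEquivProdFinsupp, h1]
      obtain ⟨l, rfl⟩ := Nat.exists_eq_add_of_le hk
      simp [ expYs_add, expYs_one, expY]
    · have h1 : ((0 : ZMod (N + 1)) - 1).val = N := by rw [zero_sub, ZMod.val_neg_one]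
      have := ZMod.val_lt (i - 1)
      omega

variable (K : Type*) [Field K]

theorem f_eq (n j : ℕ) : f K n j = monomial (ruleF n j).1 1 - monomial (ruleF n j).2 1 := by
  have h : (j : ZMod n) + (2 : ℕ) - 2 = j := by simp
  simp only [f, x, y, ruleF, expX, expY, X, monomial_mul, mul_one, h, Nat.cast_add, Nat.cast_one]

theorem monomial_expYs (n j r : ℕ) :
    monomial (expYs n j r) (1 : K) = ∏ s ∈ Finset.range r, y K n ((j + 2 * s : ℕ) : ZMod n) := by
  rw [expYs, monomial_sum_one]
  rfl

theorem filter_odd_range (k : ℕ) :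
    (Finset.range (2 * k)).filter Odd = (Finset.range k).image fun s => 1 + 2 * s := by
  ext i
  simp only [Finset.mem_filter, Finset.mem_range, Finset.mem_image]
  constructor
  · rintro ⟨hi, s, rfl⟩
    exact ⟨s, by omega, by omega⟩
  · rintro ⟨s, hs, rfl⟩
    exact ⟨by omega, s, by omega⟩

theorem filter_even_range (k : ℕ) :
    (Finset.range (2 * k)).filter Even = (Finset.range k).image fun s => 0 + 2 * s := by
  ext i
  simp only [Finset.mem_filter, Finset.mem_range, Finset.mem_image]
  constructor
  · rintro ⟨hi, s, rfl⟩
    exact ⟨s, by omega, by omega⟩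
  · rintro ⟨s, hs, rfl⟩
    exact ⟨by omega, s, by omega⟩

theorem g_eq (n k : ℕ) : g K n k = monomial (ruleG n k).1 1 - monomial (ruleG n k).2 1 := by
  have h1 : monomial (ruleG n k).1 (1 : K) = monomial (expX n (2 * k)) 1 *
      monomial (expYs n 1 k) 1 := by rw [monomial_mul, one_mul, ruleG]
  have h2 : monomial (ruleG n k).2 (1 : K) = monomial (expX n 0) 1 *
      monomial (expYs n 0 k) 1 := by rw [monomial_mul, one_mul, ruleG]
  rw [h1, h2, monomial_expYs, monomial_expYs, g, filter_odd_range, filter_even_range,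
    Finset.prod_image (by intro a _ b _ h; simpa using h),
    Finset.prod_image (by intro a _ b _ h; simpa using h)]
  simp [x, expX, X]

theorem generators_eq (n : ℕ) : generators K n =
    (fun p => monomial p.1 (1 : K) - monomial p.2 1) '' rules n := by
  ext q
  constructor
  · rintro (⟨j, hj, hj', rfl⟩ | ⟨k, hk, hk', rfl⟩)
    · exact ⟨_, .inl ⟨j, hj, hj', rfl⟩, (f_eq K n j).symm⟩
    · exact ⟨_, .inr ⟨k, hk, hk', rfl⟩, (g_eq K n k).symm⟩
  · rintro ⟨_, ⟨j, hj, hj', rfl⟩ | ⟨k, hk, hk', rfl⟩, rfl⟩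
    · exact .inl ⟨j, hj, hj', (f_eq K n j).symm⟩
    · exact .inr ⟨k, hk, hk', (g_eq K n k).symm⟩

theorem finite_generators (n : ℕ) : (generators K n).Finite := by
  refine ((Set.finite_Icc 1 (n - 1)).image (f K n)).union ((Set.finite_Icc 1 (n / 2)).image (g K n))
    |>.subset ?_
  rintro _ (⟨j, hj, hj', rfl⟩ | ⟨k, hk, hk', rfl⟩)
  · exact .inl ⟨j, ⟨hj, hj'⟩, rfl⟩
  · exact .inr ⟨k, ⟨hk, hk'⟩, rfl⟩

end CyclePath

/-! ### From confluent rules to a Gröbner basis -/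

namespace BinomialRewriting

open MvPolynomial
open scoped MonomialOrder

variable {σ K : Type*} [Field K] (m : MonomialOrder σ) {a b : σ →₀ ℕ}

theorem degree_monomial_sub_monomial_lt (h : b ≺[m] a) :
    m.degree (monomial b (1 : K)) ≺[m] m.degree (monomial a (1 : K)) := by
  classical
  simpa [m.degree_monomial] using h

theorem leadingTerm_monomial_sub_monomial (h : b ≺[m] a) :
    m.leadingTerm (monomial a (1 : K) - monomial b 1) = monomial a 1 := by
  classical
  have := degree_monomial_sub_monomial_lt (K := K) m h
  rw [MonomialOrder.leadingTerm, m.degree_sub_of_lt this, m.leadingCoeff_sub_of_lt this,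
    m.leadingCoeff_monomial, m.degree_monomial, if_neg one_ne_zero]

/-- A terminating set of rules whose critical pairs can be joined gives a Gröbner basis. -/
theorem isGroebnerBasis_of_criticalPairs {R : Set ((σ →₀ ℕ) × (σ →₀ ℕ))}
    {G : Set (MvPolynomial σ K)} (hG : G = (fun p => monomial p.1 (1 : K) - monomial p.2 1) '' R)
    (hfin : G.Finite) (hR : ∀ p ∈ R, p.2 ≺[m] p.1)
    (h : ∀ p ∈ R, ∀ q ∈ R, CriticalPairJoins R p q) :
    CyclePath.IsGroebnerBasis m G (Ideal.span G) := by
  subst hG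
  refine ⟨hfin, ?_, Ideal.subset_span, le_antisymm (Ideal.span_le.2 ?_)
    (Ideal.span_mono (Set.image_mono Ideal.subset_span))⟩
  · rintro _ ⟨p, hp, rfl⟩ h0
    have := leadingTerm_monomial_sub_monomial (K := K) m (hR p hp)
    simp only at h0
    rw [h0, m.leadingTerm_zero] at this
    simpa using this.symm
  · rintro _ ⟨q, hq, rfl⟩
    by_cases hq0 : q = 0
    · rw [hq0, m.leadingTerm_zero]
      exact zero_mem _
    obtain ⟨p, hp, hpq⟩ := exists_le_degree m hR h le_rfl hq hq0
    have : m.leadingTerm q =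
        monomial (m.degree q - p.1) (m.leadingCoeff q) * monomial p.1 1 := by
      rw [monomial_mul, mul_one, tsub_add_cancel_of_le hpq, MonomialOrder.leadingTerm]
    rw [this]
    exact Ideal.mul_mem_left _ _ (Ideal.subset_span
      ⟨_, ⟨p, hp, rfl⟩, leadingTerm_monomial_sub_monomial m (hR p hp)⟩)

end BinomialRewriting

/-! ### Presentation of the symmetric algebra of a monomial ideal -/

namespace CyclePath

open BinomialRewriting MvPolynomial

section Presentation

variable {K σ ι : Type*} [Field K]

/-- An algebra homomorphism from `K[x_i, y_j]` that identifies `a y_j` and `b y_{j'}` for all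
monomials `a` and `b` with `a u_j = b u_{j'}` factors through the symmetric algebra of the ideal
generated by the monomials `u_j`. -/
theorem eq_zero_of_mem_symDefiningIdeal {A : Type*} [CommRing A] [Algebra K A]
    {I : Ideal (MvPolynomial σ K)} {u : ι → I}
    (hI : I ≤ Ideal.span (Set.range fun j => (u j : MvPolynomial σ K))) {e : ι → σ →₀ ℕ}
    (hu : ∀ j, (u j : MvPolynomial σ K) = monomial (e j) 1) (π : MvPolynomial (σ ⊕ ι) K →ₐ[K] A)
    (hπ : ∀ a b j j', a + e j = b + e j' →
      π (rename Sum.inl (monomial a (1 : K)) * X (.inr j)) =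
        π (rename Sum.inl (monomial b (1 : K)) * X (.inr j')))
    {q : MvPolynomial (σ ⊕ ι) K} (hq : q ∈ symDefiningIdeal I u) : π q = 0 := by
  classical
  let φ : MvPolynomial σ K →ₐ[K] A := π.comp (rename Sum.inl)
  let Y : ι → A := fun j => π (X (.inr j))
  have hY : ∀ a b j j', a + e j = b + e j' → φ (monomial a 1) * Y j = φ (monomial b 1) * Y j' :=
    fun a b j j' h => by
      have := hπ a b j j' h
      rwa [map_mul, map_mul] at this
  -- By `hY` the choice of `j` does not matter. The value 0 on monomials divisible by no $u_j$ is
  -- arbitrary, since only the restriction of `ψ` to `I` is used.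
  let ψ : MvPolynomial σ K →ₗ[K] A :=
    (basisMonomials σ K).constr K fun a =>
      if h : ∃ j, e j ≤ a then φ (monomial (a - e h.choose) 1) * Y h.choose else 0
  have hψ1 : ∀ a j, ψ (monomial (a + e j) 1) = φ (monomial a 1) * Y j := fun a j => by
    have h : ∃ j', e j' ≤ a + e j := ⟨j, le_add_self⟩
    have := (basisMonomials σ K).constr_basis K (fun a =>
      if h : ∃ j, e j ≤ a then φ (monomial (a - e h.choose) (1 : K)) * Y h.choose else 0) (a + e j)
    rw [coe_basisMonomials, dif_pos h] at this
    rw [this]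
    exact hY _ _ _ _ (tsub_add_cancel_of_le h.choose_spec)
  have hψ2 : ∀ c j, ψ (c * u j) = φ c * Y j := fun c j => by
    induction c using MvPolynomial.induction_on' with
    | monomial a c =>
      have h : monomial a c = c • monomial a (1 : K) := by rw [smul_monomial, smul_eq_mul, mul_one]
      rw [h, hu, smul_mul_assoc, monomial_mul, one_mul, map_smul, hψ1, map_smul, smul_mul_assoc]
    | add p q hp hq => rw [add_mul, map_add, hp, hq, map_add, add_mul]
  -- On `I` the `K`-linear map `ψ` is linear over $S$, with $S$ acting on `A` through `φ`, so it
  -- extends to the symmetric algebra.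
  have hψ3 : ∀ p ∈ I, ∀ s, ψ (s * p) = φ s * ψ p := fun p hp => by
    refine Submodule.span_induction (p := fun p _ => ∀ s, ψ (s * p) = φ s * ψ p) ?_ (by simp) ?_ ?_
      (hI hp)
    · rintro _ ⟨j, rfl⟩ s
      have := hψ2 1 j
      rw [one_mul, map_one, one_mul] at this
      rw [hψ2, this]
    · intro p q _ _ hp hq s
      rw [mul_add, map_add, hp, hq, map_add, mul_add]
    · intro a p _ hp s
      rw [smul_eq_mul, ← mul_assoc, hp, hp, map_mul, mul_assoc]
  let : Algebra (MvPolynomial σ K) A := φ.toRingHom.toAlgebra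
  let l : I →ₗ[MvPolynomial σ K] A :=
    { toFun := fun p => ψ p
      map_add' := fun p q => map_add ψ _ _
      map_smul' := fun s p => hψ3 p p.2 s }
  have hl : ∀ j, l (u j) = Y j := fun j => by
    have := hψ2 1 j
    rwa [one_mul, map_one, one_mul] at this
  -- Thus `π` factors through the map whose kernel is `symDefiningIdeal I u`.
  have hcomp : (SymmetricAlgebra.lift l).toRingHom.comp (eval₂Hom
      ((algebraMap (MvPolynomial σ K) (SymmetricAlgebra (MvPolynomial σ K) I)).comp C)
      (Sum.elim (fun i => algebraMap (MvPolynomial σ K) _ (X i))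
        (fun j => SymmetricAlgebra.ι (MvPolynomial σ K) I (u j)))) = π.toRingHom := by
    have halg : ∀ s, algebraMap (MvPolynomial σ K) A s = π (rename Sum.inl s) := fun s => rfl
    refine MvPolynomial.ringHom_ext (fun c => ?_) ?_
    · simp [halg]
    · rintro (i | j)
      · simp [halg]
      · simp [hl, Y]
  rw [symDefiningIdeal, RingHom.mem_ker] at hq
  have := congrArg (fun F => F q) hcomp
  simp only [RingHom.comp_apply, hq, map_zero] at this
  exact this.symm

/-- The defining ideal of the symmetric algebra of an ideal generated by monomials `u_j` is
generated by the linear forms `a y_j - b y_{j'}`, where `a` and `b` are monomials with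
`a u_j = b u_{j'}`. -/
theorem symDefiningIdeal_le {I : Ideal (MvPolynomial σ K)} {u : ι → I}
    (hI : I ≤ Ideal.span (Set.range fun j => (u j : MvPolynomial σ K))) {e : ι → σ →₀ ℕ}
    (hu : ∀ j, (u j : MvPolynomial σ K) = monomial (e j) 1) {J : Ideal (MvPolynomial (σ ⊕ ι) K)}
    (hJ : ∀ a b j j', a + e j = b + e j' →
      rename Sum.inl (monomial a (1 : K)) * X (.inr j) -
        rename Sum.inl (monomial b (1 : K)) * X (.inr j') ∈ J) :
    symDefiningIdeal I u ≤ J := fun q hq => by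
  refine Ideal.Quotient.eq_zero_iff_mem.1 (eq_zero_of_mem_symDefiningIdeal hI hu
    (Ideal.Quotient.mkₐ K J) (fun a b j j' h => ?_) hq)
  exact Ideal.Quotient.eq.2 (hJ a b j j' h)

end Presentation

variable {n : ℕ}

/-! ### Paths in a cycle -/

section Paths

theorem cycle_adj {a b : ZMod n} (h : (cycle n).Adj a b) : b = a + 1 ∨ b = a - 1 := by
  rw [cycle, SimpleGraph.circulantGraph_adj] at h
  simp only [Set.mem_singleton_iff] at h
  rcases h.2 with h | h
  · right
    rw [← h]
    ring
  · left
    rw [← h]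
    ring

/-- Reversing direction would return to the vertex visited two steps earlier, so the first step
determines all others. -/
theorem eq_add_mul_of_step {t : ℕ} {p : ℕ → ZMod n} {c : ZMod n}
    (hinj : ∀ i, i + 2 < t → p (i + 2) ≠ p i)
    (hadj : ∀ i, i + 1 < t → p (i + 1) = p i + c ∨ p (i + 1) = p i - c)
    (h1 : p 1 = p 0 + c) (i : ℕ) (hi : i + 1 < t) :
    p i = p 0 + i * c ∧ p (i + 1) = p 0 + (i + 1) * c := by
  induction i with
  | zero => simp [h1]
  | succ i ih =>
    obtain ⟨h2, h3⟩ := ih (by omega)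
    refine ⟨by rw [h3]; push_cast; ring, ?_⟩
    rcases hadj (i + 1) hi with h | h
    · rw [h, h3]
      push_cast
      ring
    · refine absurd ?_ (hinj i hi)
      rw [h, h3, h2]
      ring

/-- A path in a cycle runs in one direction. -/
theorem exists_eq_add_or_sub {t : ℕ} {p : ℕ → ZMod n}
    (hinj : ∀ i, i + 2 < t → p (i + 2) ≠ p i)
    (hadj : ∀ i, i + 1 < t → p (i + 1) = p i + 1 ∨ p (i + 1) = p i - 1) :
    (∀ i < t, p i = p 0 + i) ∨ ∀ i < t, p i = p 0 - i := by
  by_cases ht : 1 < t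
  · rcases hadj 0 ht with h | h
    · left
      intro i hi
      cases i with
      | zero => simp
      | succ i => simpa using (eq_add_mul_of_step hinj hadj h i hi).2
    · right
      intro i hi
      cases i with
      | zero => simp
      | succ i =>
        have := (eq_add_mul_of_step (c := -1) hinj
          (fun i hi => by simpa [sub_eq_add_neg] using (hadj i hi).symm)
          (by rw [h, sub_eq_add_neg]) i hi).2
        rw [this]
        push_cast
        ring
  · left
    intro i hi
    obtain rfl : i = 0 := by omega
    simp

theorem arcMonomial_eq (K : Type*) [Field K] (n t : ℕ) (j : ZMod n) :
    arcMonomial K n t j = ∏ i ∈ Finset.range t, X (j + (i : ZMod n)) :=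
  Fin.prod_univ_eq_prod_range (fun i => X (j + (i : ZMod n))) t

/-- The path ideals of a cycle are generated by the monomials of its arcs. -/
theorem pathIdeal_cycle_le (K : Type*) [Field K] (n t : ℕ) :
    pathIdeal K (cycle n) t ≤ Ideal.span (Set.range (arcMonomial K n t)) := by
  refine Ideal.span_le.2 ?_
  rintro _ ⟨p, ⟨hinj, hadj⟩, rfl⟩
  refine Ideal.subset_span ?_
  let q : ℕ → ZMod n := fun i => if h : i < t then p ⟨i, h⟩ else 0
  have hq : ∀ i (h : i < t), q i = p ⟨i, h⟩ := fun i h => dif_pos h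
  have hprod : ∏ i, X (R := K) (p i) = ∏ i ∈ Finset.range t, X (q i) := by
    rw [← Fin.prod_univ_eq_prod_range]
    exact Finset.prod_congr rfl fun i _ => by rw [hq i i.2]
  rw [hprod]
  rcases exists_eq_add_or_sub (t := t) (p := q)
    (fun i hi h => by
      rw [hq _ hi, hq i (by omega)] at h
      have := congrArg Fin.val (hinj h)
      simp at this)
    (fun i hi => by
      rw [hq _ hi, hq i (by omega)]
      exact cycle_adj (hadj i hi)) with h | h
  · refine ⟨q 0, ?_⟩
    rw [arcMonomial_eq]
    exact Finset.prod_congr rfl fun i hi => by rw [h i (Finset.mem_range.1 hi)]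
  -- A descending path is an arc read backwards, so the arc begins at the last vertex of the path.
  · refine ⟨q 0 - ((t - 1 : ℕ) : ZMod n), ?_⟩
    rw [arcMonomial_eq, ← Finset.prod_range_reflect]
    refine Finset.prod_congr rfl fun i hi => ?_
    have hi := Finset.mem_range.1 hi
    rw [h i hi, Nat.cast_sub (by omega : i ≤ t - 1)]
    congr 1
    ring

end Paths

/-! ### The polynomials $f_j$ and $g_k$ generate $L$ -/

section Generators

variable (K : Type*) [Field K]

/-- Since $x_{j-2}=x_{j+n-2}$, both sides are the product of the $n-1$ consecutive variables
starting at $x_j$. -/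
theorem X_mul_arcMonomial (hn : 2 ≤ n) (j : ZMod n) :
    X (j - 2) * arcMonomial K n (n - 2) j = X j * arcMonomial K n (n - 2) (j + 1) := by
  have h1 := Finset.prod_range_succ (fun i : ℕ => X (R := K) (j + (i : ZMod n))) (n - 2)
  rw [Finset.prod_range_succ'] at h1
  simp only [Nat.cast_zero, add_zero, Nat.cast_succ] at h1
  rw [Nat.cast_sub hn, ZMod.natCast_self, zero_sub, Nat.cast_ofNat, ← sub_eq_add_neg] at h1
  rw [arcMonomial_eq, arcMonomial_eq, mul_comm, ← h1, mul_comm]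
  congr 1
  exact Finset.prod_congr rfl fun i _ => by rw [add_assoc, add_comm (1 : ZMod n)]

theorem f_mem_idealL (hn : 3 ≤ n) (j : ℕ) : f K n j ∈ idealL K n hn := by
  rw [idealL, symDefiningIdeal, RingHom.mem_ker]
  simp only [f, x, y, map_sub, map_mul, coe_eval₂Hom, eval₂_X, Sum.elim_inl, Sum.elim_inr,
    ← Algebra.smul_def, ← map_smul]
  rw [sub_eq_zero]
  congr 1
  exact Subtype.ext (X_mul_arcMonomial K (by omega) _)

theorem g_zero (n : ℕ) : g K n 0 = 0 := by simp [g]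

/-- This recursion, started at $g_0=0$, puts every $g_k$ in the ideal of the $f_j$, with $f_0$
included; its case $k=0$ reads $g_1=-f_0$. -/
theorem g_succ (n k : ℕ) : g K n (k + 1) = y K n ((2 * k : ℕ) : ZMod n) * g K n k -
    (∏ i ∈ (Finset.range (2 * k)).filter Odd, y K n (i : ZMod n)) * f K n (2 * k) := by
  have h1 : (Finset.range (2 * (k + 1))).filter Odd =
      insert (2 * k + 1) ((Finset.range (2 * k)).filter Odd) := by
    rw [show 2 * (k + 1) = 2 * k + 1 + 1 by ring, Finset.range_add_one, Finset.filter_insert,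
      if_pos (odd_two_mul_add_one k), Finset.range_add_one, Finset.filter_insert,
      if_neg (by simp)]
  have h2 : (Finset.range (2 * (k + 1))).filter Even =
      insert (2 * k) ((Finset.range (2 * k)).filter Even) := by
    rw [show 2 * (k + 1) = 2 * k + 1 + 1 by ring, Finset.range_add_one, Finset.filter_insert,
      if_neg (by simp), Finset.range_add_one, Finset.filter_insert, if_pos (even_two_mul k)]
  rw [g, h1, h2, Finset.prod_insert (by simp), Finset.prod_insert (by simp), g, f]
  push_cast
  rw [show 2 * ((k : ZMod n) + 1) - 2 = 2 * k by ring]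
  ring

theorem g_mem_of_f_mem {J : Ideal (MvPolynomial (ZMod n ⊕ ZMod n) K)} (hJ : ∀ j, f K n j ∈ J)
    (k : ℕ) : g K n k ∈ J := by
  induction k with
  | zero => rw [g_zero]; exact zero_mem _
  | succ k ih =>
    rw [g_succ]
    exact sub_mem (Ideal.mul_mem_left _ _ ih) (Ideal.mul_mem_left _ _ (hJ _))

theorem generators_subset_idealL (hn : 3 ≤ n) :
    generators K n ⊆ idealL K n hn := by
  rintro _ (⟨j, -, -, rfl⟩ | ⟨k, -, -, rfl⟩)
  · exact f_mem_idealL K hn j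
  · exact g_mem_of_f_mem K (f_mem_idealL K hn) k

theorem linearForm_mem_span (hn : 3 ≤ n) (j : ZMod n) :
    x K n (j - 2) * y K n j - x K n j * y K n (j + 1) ∈ Ideal.span (generators K n) := by
  have : NeZero n := ⟨by omega⟩
  have hf : x K n (j - 2) * y K n j - x K n j * y K n (j + 1) = f K n j.val := by
    rw [f, ZMod.natCast_rightInverse j]
  rw [hf]
  by_cases h0 : j.val = 0
  · have h := g_succ K n 0
    simp only [g_zero, mul_zero, Finset.range_zero, Finset.filter_empty, Finset.prod_empty,
      one_mul, zero_sub, zero_add] at h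
    rw [h0, ← neg_neg (f K n 0), ← h]
    exact neg_mem (Ideal.subset_span (.inr ⟨1, le_rfl, by omega, rfl⟩))
  · have := ZMod.val_lt j
    exact Ideal.subset_span (.inl ⟨j.val, by omega, by omega, rfl⟩)

theorem edgeForm_mem_span (hn : 3 ≤ n) (i j : ZMod n) :
    x K n (i - 2) * x K n (i - 1) * y K n i - x K n (j - 2) * x K n (j - 1) * y K n j ∈
      Ideal.span (generators K n) := by
  have : NeZero n := ⟨by omega⟩
  have key : ∀ d : ℕ, x K n (i - 2) * x K n (i - 1) * y K n i -
      x K n (i + d - 2) * x K n (i + d - 1) * y K n (i + d) ∈ Ideal.span (generators K n) := by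
    intro d
    induction d with
    | zero => simp
    | succ d ih =>
      -- Multiplying the linear form at $j$ by $x_{j-1}$ gives the difference of the edge forms at
      -- $j$ and $j+1$, so the sum telescopes.
      have h := add_mem ih (Ideal.mul_mem_left _ (x K n (i + d - 1))
        (linearForm_mem_span K hn (i + d)))
      convert h using 1
      rw [Nat.cast_succ, show i + ((d : ZMod n) + 1) - 2 = i + d - 1 by ring,
        show i + ((d : ZMod n) + 1) - 1 = i + d by ring, ← add_assoc]
      ring
  have := key (j - i).val
  rwa [ZMod.natCast_rightInverse (j - i), add_sub_cancel] at this

/-- The exponent of `x_j x_{j+1} ⋯ x_{j+t-1}`. -/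
noncomputable def arcExponent (n t : ℕ) (j : ZMod n) : ZMod n →₀ ℕ :=
  ∑ i ∈ Finset.range t, Finsupp.single (j + (i : ZMod n)) 1

theorem arcMonomial_eq_monomial (t : ℕ) (j : ZMod n) :
    arcMonomial K n t j = monomial (arcExponent n t j) 1 := by
  rw [arcMonomial_eq, arcExponent, monomial_sum_one]
  rfl

theorem arcExponent_self_add_one (j : ZMod n) : arcExponent n n (j + 1) = arcExponent n n j := by
  have h := Finset.sum_range_succ (fun i : ℕ => Finsupp.single (j + (i : ZMod n)) 1) n
  rw [Finset.sum_range_succ'] at h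
  simp only [Nat.cast_zero, add_zero, ZMod.natCast_self] at h
  have h' := add_right_cancel h
  rw [arcExponent, arcExponent, ← h']
  exact Finset.sum_congr rfl fun i _ => by
    rw [Nat.cast_succ, add_assoc, add_comm (1 : ZMod n)]

theorem arcExponent_self_eq (hn : n ≠ 0) (j : ZMod n) : arcExponent n n j = arcExponent n n 0 := by
  have : NeZero n := ⟨hn⟩
  have key : ∀ d : ℕ, arcExponent n n (d : ZMod n) = arcExponent n n 0 := by
    intro d
    induction d with
    | zero => simp
    | succ d ih => rw [Nat.cast_succ, arcExponent_self_add_one, ih]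
  rw [← ZMod.natCast_rightInverse j]
  exact key _

/-- The exponent of `x_{j-2} x_{j-1}`. -/
noncomputable def edgeExponent (j : ZMod n) : ZMod n →₀ ℕ :=
  Finsupp.single (j - 2) 1 + Finsupp.single (j - 1) 1

/-- The arc and the edge are complementary: together they use each variable once. Syzygies of arcs
thereby become conditions on edges, whose overlaps are easy to list. -/
theorem arcExponent_add_edgeExponent (hn : 2 ≤ n) (j : ZMod n) :
    arcExponent n (n - 2) j + edgeExponent j = arcExponent n n 0 := by
  rw [← arcExponent_self_eq (by omega) j]
  obtain ⟨t, rfl⟩ := Nat.exists_eq_add_of_le' hn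
  have h : (t : ZMod (t + 2)) + 2 = 0 := by exact_mod_cast ZMod.natCast_self (t + 2)
  have h1 : j + (t : ZMod (t + 2)) = j - 2 := by linear_combination h
  have h2 : j + ((t : ZMod (t + 2)) + 1) = j - 1 := by linear_combination h
  rw [arcExponent, arcExponent, Finset.sum_range_succ, Finset.sum_range_succ, Nat.cast_succ, h1, h2,
    add_assoc]
  rfl

theorem rename_monomial_add (a b : ZMod n →₀ ℕ) :
    rename (Sum.inl : _ → ZMod n ⊕ ZMod n) (monomial (a + b) (1 : K)) =
      rename Sum.inl (monomial a 1) * rename Sum.inl (monomial b 1) := by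
  rw [← map_mul, monomial_mul, one_mul]

theorem rename_monomial_single (i : ZMod n) :
    rename (Sum.inl : _ → ZMod n ⊕ ZMod n) (monomial (Finsupp.single i 1) (1 : K)) = x K n i :=
  rename_X _ _

theorem single_disjoint {i j : ZMod n} (hij : i ≠ j) (z : ZMod n) :
    Finsupp.single i 1 z = 0 ∨ Finsupp.single j 1 z = 0 := by
  by_cases h : z = i
  · exact .inr (Finsupp.single_eq_of_ne (h ▸ hij))
  · exact .inl (Finsupp.single_eq_of_ne h)

theorem syzygy_adjacent_mem_span (hn : 3 ≤ n) {a b : ZMod n →₀ ℕ} {j : ZMod n}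
    (h : a + edgeExponent (j + 1) = b + edgeExponent j) :
    rename Sum.inl (monomial a (1 : K)) * y K n j -
      rename Sum.inl (monomial b (1 : K)) * y K n (j + 1) ∈ Ideal.span (generators K n) := by
  have hne : j ≠ j - 2 := fun h => by
    have := natCast_ne_natCast (n := n) (a := 0) (b := 2) (by omega) (by omega)
    push_cast at this
    exact this (by linear_combination -h)
  -- The consecutive edges share $x_{j-1}$; once it is cancelled, the coprime variables $x_j$ and
  -- $x_{j-2}$ remain.
  have h' : Finsupp.single j 1 + a = Finsupp.single (j - 2) 1 + b := by
    refine add_right_cancel (b := Finsupp.single (j - 1) 1) ?_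
    rw [edgeExponent, edgeExponent, show j + 1 - 2 = j - 1 by ring, add_sub_cancel_right] at h
    rw [add_comm _ a, add_assoc, add_comm (Finsupp.single j 1), h]
    abel
  obtain ⟨u, rfl, rfl⟩ := exists_eq_add_of_add_eq_add (single_disjoint hne) h'
  rw [rename_monomial_add, rename_monomial_add, rename_monomial_single, rename_monomial_single]
  convert Ideal.mul_mem_left _ (rename Sum.inl (monomial u (1 : K)))
    (linearForm_mem_span K hn j) using 1
  ring

theorem syzygy_mem_span (hn : 3 ≤ n) {a b : ZMod n →₀ ℕ} {i j : ZMod n}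
    (h : a + edgeExponent j = b + edgeExponent i) :
    rename Sum.inl (monomial a (1 : K)) * y K n i -
      rename Sum.inl (monomial b (1 : K)) * y K n j ∈ Ideal.span (generators K n) := by
  by_cases h0 : i = j
  · subst h0
    rw [add_right_cancel h, sub_self]
    exact zero_mem _
  by_cases h1 : j = i + 1
  · subst h1
    exact syzygy_adjacent_mem_span K hn h
  by_cases h2 : i = j + 1
  · subst h2
    rw [← neg_sub]
    exact neg_mem (syzygy_adjacent_mem_span K hn h.symm)
  -- Edges that are neither equal nor consecutive are disjoint, so their monomials are coprime.
  have hdisj : ∀ z, edgeExponent j z = 0 ∨ edgeExponent i z = 0 := fun z => by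
    simp only [edgeExponent, Finsupp.add_apply, Finsupp.single_apply, Nat.add_eq_zero_iff,
      ite_eq_right_iff, one_ne_zero, imp_false]
    by_contra! hcon
    obtain ⟨hj, hi⟩ := hcon
    by_cases hj' : j - 2 = z <;> by_cases hi' : i - 2 = z
    · exact h0 (by linear_combination hi' - hj')
    · exact h1 (by linear_combination hj' - hi hi')
    · exact h2 (by linear_combination hi' - hj hj')
    · exact h0 (by linear_combination hi hi' - hj hj')
  obtain ⟨u, rfl, rfl⟩ := exists_eq_add_of_add_eq_add hdisj
    (by rw [add_comm, h, add_comm] : edgeExponent j + a = edgeExponent i + b)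
  rw [rename_monomial_add, rename_monomial_add, edgeExponent, edgeExponent, rename_monomial_add,
    rename_monomial_add]
  simp only [rename_monomial_single]
  convert Ideal.mul_mem_left _ (rename Sum.inl (monomial u (1 : K)))
    (edgeForm_mem_span K hn i j) using 1
  ring

theorem idealL_le_span (hn : 3 ≤ n) : idealL K n hn ≤ Ideal.span (generators K n) := by
  rw [idealL]
  refine symDefiningIdeal_le (e := arcExponent n (n - 2)) ?_ (fun j => ?_) fun a b i j h =>
    syzygy_mem_span K hn ?_
  · exact pathIdeal_cycle_le K n (n - 2)
  · exact arcMonomial_eq_monomial K (n - 2) j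
  have hi := arcExponent_add_edgeExponent (show 2 ≤ n by omega) i
  have hj := arcExponent_add_edgeExponent (show 2 ≤ n by omega) j
  -- Adding the exponent of the product of all variables trades each arc for its complementary edge.
  refine add_right_cancel (b := arcExponent n n 0) ?_
  calc a + edgeExponent j + arcExponent n n 0
      = a + arcExponent n (n - 2) i + edgeExponent i + edgeExponent j := by rw [← hi]; abel
    _ = b + edgeExponent i + (arcExponent n (n - 2) j + edgeExponent j) := by rw [h]; abel
    _ = b + edgeExponent i + arcExponent n n 0 := by rw [hj]

end Generators

end CyclePath

theorem mainTheorem9 {K : Type*} [Field K] (n : ℕ) (hn : 3 ≤ n)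
    (m₁ : MonomialOrder (ZMod n)) (m₂ : MonomialOrder (ZMod n))
    (m : MonomialOrder (ZMod n ⊕ ZMod n))
    (hm₁ : CyclePath.IsRevLex m₁ (fun j : ZMod n => (j - 1).val))
    (hm : CyclePath.IsProductOrder m m₁ m₂) :
    Ideal.span (CyclePath.generators K n) = CyclePath.idealL K n hn ∧
      CyclePath.IsGroebnerBasis m (CyclePath.generators K n) (CyclePath.idealL K n hn) := by
  have h : Ideal.span (CyclePath.generators K n) = CyclePath.idealL K n hn :=
    le_antisymm (Ideal.span_le.2 (CyclePath.generators_subset_idealL K hn))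
      (CyclePath.idealL_le_span K hn)
  refine ⟨h, ?_⟩
  rw [← h]
  exact BinomialRewriting.isGroebnerBasis_of_criticalPairs m (CyclePath.generators_eq K n)
    (CyclePath.finite_generators K n) (CyclePath.rules_lt hm₁ hm)
    CyclePath.criticalPairJoins_rules
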